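/- A category $\mathcal K$ is \emph{weakly locally finitely presentable} if it is finitely accessible and every small diagram $F$ in it has a weak colimit, i.e. a cocone through which every cocone under $F$ factors, not necessarily uniquely. A full subcategory of a locally finitely presentable category $\mathcal K$ is a \emph{definable subcategory} if it is closed in $\mathcal K$ under (small) products, (small) directed colimits and pure subobjects, where a morphism $f\colon A\to B$ is pure if for all $g\colon X\to Y$ with $X,Y$ finitely presentable and all $u\colon X\to A$, $w\colon Y\to B$ with $fu=wg$, the morphism $u$ factors through $g$. A category is \emph{definable} if it is equivalent to a definable subcategory of some locally finitely presentable category. A class of objects of $\mathcal K$ is a \emph{finite-injectivity class} if there is a set $\mathcal M$ of morphisms with finitely presentable domains and codomains such that the class consists precisely of those objects $X$ that are injective with respect to every $h\colon A\to B$ in $\mathcal M$ (every morphism $A\to X$ factors through $h$). \textbf{Proposition.} Every weakly locally finitely presentable category $\mathcal L$ is definable. More precisely, $\mathcal L$ is equivalent to $\operatorname{Ind}\mathcal C$ for some small category $\mathcal C$, and for every small category $\mathcal C$ with $\mathcal L\simeq\operatorname{Ind}\mathcal C$, the presheaves on $\mathcal C$ isomorphic to an object in the image of the canonical full embedding $\operatorname{Ind}\mathcal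 C\to\mathbf{Set}^{\mathcal C^{op}}$ form a finite-injectivity class in $\mathbf{Set}^{\mathcal C^{op}}$. -/

import Mathlib

universe v u

open CategoryTheory CategoryTheory.Limits

namespace DefinableCat

/-- A cocone `c` under `F` is a weak colimit of `F` if every cocone under `F` factors through `c`
(not necessarily uniquely). -/
def IsWeakColimit {J : Type*} [Category* J] {K : Type*} [Category* K] {F : J ⥤ K}
    (c : Cocone F) : Prop :=
  ∀ s : Cocone F, ∃ d : c.pt ⟶ s.pt, ∀ j : J, c.ι.app j ≫ d = s.ι.app j

/-- The category `K`, with hom-sets in `Type v`, has weak colimits of all small diagrams. -/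
def HasWeakColimits (K : Type u) [Category.{v} K] : Prop :=
  ∀ (J : Type v) [SmallCategory J] (F : J ⥤ K), ∃ c : Cocone F, IsWeakColimit c

/-- A category is weakly locally finitely presentable if it is finitely accessible
and has weak colimits. -/
structure IsWeaklyLocallyFinitelyPresentable (K : Type u) [Category.{v} K] : Prop where
  isFinitelyAccessible : IsFinitelyAccessibleCategory.{v} K
  hasWeakColimits : HasWeakColimits K

/-- A morphism `f : A ⟶ B` is pure if in each commutative square `u ≫ f = g ≫ w` with
`g : X ⟶ Y` a morphism between finitely presentable objects, `u : X ⟶ A` factors through `g`.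
(In a finitely accessible category, such morphisms are automatically monomorphisms, so a
pure subobject of `B` is the same thing as a pure morphism with target `B`.) -/
def IsPure {K : Type u} [Category.{v} K] {A B : K} (f : A ⟶ B) : Prop :=
  ∀ ⦃X Y : K⦄, IsFinitelyPresentable.{v} X → IsFinitelyPresentable.{v} Y →
    ∀ (g : X ⟶ Y) (u : X ⟶ A) (w : Y ⟶ B), u ≫ f = g ≫ w → ∃ t : Y ⟶ A, g ≫ t = u

/-- The full subcategory of `K` on the objects satisfying `P` is closed in `K` under small
products, colimits of (nonempty) small directed diagrams, and pure subobjects. -/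
structure IsDefinableSubcategory {K : Type u} [Category.{v} K] (P : ObjectProperty K) :
    Prop where
  closed_products : ∀ I : Type v, P.IsClosedUnderLimitsOfShape (Discrete I)
  closed_directedColimits : ∀ (I : Type v) [PartialOrder I] [IsDirectedOrder I] [Nonempty I],
    P.IsClosedUnderColimitsOfShape I
  closed_pureSubobjects : ∀ ⦃A B : K⦄ (f : A ⟶ B), IsPure f → P B → P A

/-- A category is definable if it is equivalent to a definable subcategory of a locally
finitely presentable category. -/
def IsDefinable (L : Type u) [Category.{v} L] : Prop :=
  ∃ (K : Type (v + 1)) (_ : Category.{v} K) (P : ObjectProperty K),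
    IsLocallyFinitelyPresentable.{v} K ∧ IsDefinableSubcategory P ∧
      Nonempty (L ≌ P.FullSubcategory)

/-- The object `X` is injective with respect to the morphism `h`. -/
def IsInjectiveWrt {K : Type u} [Category.{v} K] (X : K) {A B : K} (h : A ⟶ B) : Prop :=
  ∀ a : A ⟶ X, ∃ b : B ⟶ X, h ≫ b = a

/-- The objects satisfying `P` are precisely those that are injective with respect to all
morphisms of some (small) set `M` of morphisms with finitely presentable domains and codomains. -/
def IsFiniteInjectivityClass {K : Type u} [Category.{v} K] (P : ObjectProperty K) : Prop :=
  ∃ M : MorphismProperty K, MorphismProperty.IsSmall.{v} M ∧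
    (∀ ⦃A B : K⦄ (h : A ⟶ B), M h → IsFinitelyPresentable.{v} A ∧ IsFinitelyPresentable.{v} B) ∧
    ∀ X : K, P X ↔ ∀ ⦃A B : K⦄ (h : A ⟶ B), M h → IsInjectiveWrt X h

end DefinableCat

/-!
The finitely presentable objects of a finitely accessible category `L` form a dense essentially
small subcategory over which every object is a small filtered colimit, so the restricted Yoneda
functor identifies `L` with a category `Ind C`.

Inside `Cᵒᵖ ⥤ Type v`, the ind-objects are the presheaves `P` whose category of elements is
filtered, i.e. in which three finite shapes of diagrams always admit a cocone. A diagram of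
elements of `P` over `D : J ⥤ C` is a morphism `colim yD ⟶ P`, with `y` the Yoneda embedding, and
if `D` has a weak colimit `W` then it admits a cocone if and only if this morphism factors through
the comparison `colim yD ⟶ yW`. Hence filteredness is injectivity with respect to these
comparisons. A weak colimit of `D` in `C` exists because one exists in `L`, and its cocone factors
through an object of `C`, again by filteredness.
-/

namespace DefinableCat

section Injectivity

variable {K : Type u} [Category.{v} K] {A B : K} {h : A ⟶ B}

lemma IsInjectiveWrt.of_isLimit {I : Type*} {F : Discrete I ⥤ K} {c : Cone F} (hc : IsLimit c)
    (hF : ∀ i, IsInjectiveWrt (F.obj i) h) : IsInjectiveWrt c.pt h := by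
  intro a
  choose b hb using fun i ↦ hF i (a ≫ c.π.app i)
  refine ⟨hc.lift ⟨B, Discrete.natTrans b⟩, hc.hom_ext fun i ↦ ?_⟩
  rw [Category.assoc, hc.fac]
  exact hb i

lemma IsInjectiveWrt.of_isColimit [IsFinitelyPresentable.{v} A] {J : Type v} [SmallCategory J]
    [IsFiltered J] {F : J ⥤ K} {c : Cocone F} (hc : IsColimit c)
    (hF : ∀ j, IsInjectiveWrt (F.obj j) h) : IsInjectiveWrt c.pt h := by
  intro a
  obtain ⟨j, a', rfl⟩ := IsFinitelyPresentable.exists_hom_of_isColimit hc a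
  obtain ⟨b, rfl⟩ := hF j a'
  exact ⟨b ≫ c.ι.app j, (Category.assoc _ _ _).symm⟩

lemma IsInjectiveWrt.of_isPure [hA : IsFinitelyPresentable.{v} A]
    [hB : IsFinitelyPresentable.{v} B] {X Y : K} {f : X ⟶ Y} (hf : IsPure f)
    (hY : IsInjectiveWrt Y h) : IsInjectiveWrt X h := by
  intro a
  obtain ⟨w, hw⟩ := hY (a ≫ f)
  exact hf hA hB h a w hw.symm

theorem IsFiniteInjectivityClass.isDefinableSubcategory {P : ObjectProperty K}
    (hP : IsFiniteInjectivityClass P) : IsDefinableSubcategory P := by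
  obtain ⟨M, -, hM, hPM⟩ := hP
  refine ⟨fun I ↦ ⟨?_⟩, fun I _ _ _ ↦ ⟨?_⟩, fun X Y f hf hY ↦ (hPM X).2 fun A B h hh ↦ ?_⟩
  · rintro X ⟨p⟩
    exact (hPM X).2 fun A B h hh ↦
      .of_isLimit p.isLimit fun i ↦ (hPM _).1 (p.prop_diag_obj i) h hh
  · rintro X ⟨p⟩
    refine (hPM X).2 fun A B h hh ↦ ?_
    have := (hM h hh).1
    exact .of_isColimit p.isColimit fun i ↦ (hPM _).1 (p.prop_diag_obj i) h hh
  · obtain ⟨_, _⟩ := hM h hh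
    exact .of_isPure hf ((hPM Y).1 hY h hh)

lemma isSmall_sup (M N : MorphismProperty K) [MorphismProperty.IsSmall.{v} M]
    [MorphismProperty.IsSmall.{v} N] : MorphismProperty.IsSmall.{v} (M ⊔ N) :=
  ⟨inferInstanceAs (Small.{v} (M.toSet ∪ N.toSet : Set (Arrow K)))⟩

lemma IsFiniteInjectivityClass.inf {P Q : ObjectProperty K} (hP : IsFiniteInjectivityClass P)
    (hQ : IsFiniteInjectivityClass Q) : IsFiniteInjectivityClass (P ⊓ Q) := by
  obtain ⟨M, _, hM, hPM⟩ := hP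
  obtain ⟨N, _, hN, hQN⟩ := hQ
  refine ⟨M ⊔ N, isSmall_sup M N, fun A B h hh ↦ hh.elim (hM h) (hN h), fun X ↦ ?_⟩
  refine ((hPM X).and (hQN X)).trans ⟨fun hX A B h hh ↦ hh.elim (hX.1 h) (hX.2 h), fun hX ↦ ?_⟩
  exact ⟨fun A B h hh ↦ hX h (.inl hh), fun A B h hh ↦ hX h (.inr hh)⟩

theorem isDefinable_of_isFiniteInjectivityClass_essImage {L : Type*} [Category.{v} L]
    {K : Type (v + 1)} [Category.{v} K] [IsLocallyFinitelyPresentable.{v} K] (F : L ⥤ K)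
    [F.Full] [F.Faithful] (hF : IsFiniteInjectivityClass F.essImage) : IsDefinable L :=
  have : F.toEssImage.IsEquivalence := { }
  ⟨K, inferInstance, F.essImage, inferInstance, hF.isDefinableSubcategory,
    ⟨F.toEssImage.asEquivalence⟩⟩

end Injectivity

section WeakColimits

variable {J C : Type*} [Category* J] [Category* C]

lemma isWeakColimit_iff_nonempty_hom {F : J ⥤ C} {c : Cocone F} :
    IsWeakColimit c ↔ ∀ s : Cocone F, Nonempty (c ⟶ s) :=
  forall_congr' fun _ ↦ ⟨fun ⟨d, hd⟩ ↦ ⟨⟨d, hd⟩⟩, fun ⟨d⟩ ↦ ⟨d.hom, d.w⟩⟩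

lemma IsWeakColimit.map_equivalence {J' C' : Type*} [Category* J'] [Category* C'] {F : J ⥤ C}
    {G : J' ⥤ C'} {c : Cocone F} (hc : IsWeakColimit c) (e : Cocone F ≌ Cocone G) :
    IsWeakColimit (e.functor.obj c) := by
  rw [isWeakColimit_iff_nonempty_hom] at hc ⊢
  exact fun s ↦ (hc (e.inverse.obj s)).map (e.toAdjunction.homEquiv c s).symm

/-- Existence of weak colimits of all diagrams of shape `J`: the weak analogue of
`HasColimitsOfShape`. -/
def HasWeakColimitsOfShape (J : Type*) [Category* J] (C : Type*) [Category* C] : Prop :=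
  ∀ F : J ⥤ C, ∃ c : Cocone F, IsWeakColimit c

/-- Existence of weak colimits of all finite diagrams: the weak analogue of `HasFiniteColimits`,
with shapes in `Type` as in that definition. -/
def HasFiniteWeakColimits (C : Type*) [Category* C] : Prop :=
  ∀ (J : Type) [SmallCategory J] [FinCategory J], HasWeakColimitsOfShape J C

lemma HasWeakColimitsOfShape.of_equivalence {J' : Type*} [Category* J'] (e : J ≌ J')
    (h : HasWeakColimitsOfShape J C) : HasWeakColimitsOfShape J' C := by
  intro F
  obtain ⟨c, hc⟩ := h (e.functor ⋙ F)
  exact ⟨_, hc.map_equivalence (Cocone.equivalenceOfReindexing e (Iso.refl _)).symm⟩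

lemma HasWeakColimits.hasFiniteWeakColimits {K : Type u} [Category.{v} K]
    (hK : HasWeakColimits K) : HasFiniteWeakColimits K := fun J _ _ ↦
  .of_equivalence (ULiftHomULiftCategory.equiv.{v, v} J).symm fun F ↦
    hK (ULiftHom.{v} (ULift.{v} J)) F

end WeakColimits

section CostructuredArrow

variable {J C K : Type*} [Category* J] [Category* C] [Category* K]

lemma nonempty_cocone_costructuredArrow_iff {S : C ⥤ K} {X : K} {F : J ⥤ CostructuredArrow S X} :
    Nonempty (Cocone F) ↔ ∃ (t : Cocone (F ⋙ CostructuredArrow.proj S X)) (q : S.obj t.pt ⟶ X),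
      ∀ j, S.map (t.ι.app j) ≫ q = (F.obj j).hom := by
  refine ⟨fun ⟨c⟩ ↦ ⟨(CostructuredArrow.proj S X).mapCocone c, c.pt.hom,
    fun j ↦ CostructuredArrow.w (c.ι.app j)⟩, fun ⟨t, q, hq⟩ ↦ ⟨⟨CostructuredArrow.mk q, ?_⟩⟩⟩
  exact
    { app j := CostructuredArrow.homMk (t.ι.app j) (hq j)
      naturality j k f := by ext; exact t.ι.naturality f }

lemma HasWeakColimitsOfShape.of_representablyCoflat {J : Type*} [SmallCategory J] [FinCategory J]
    (S : C ⥤ K) [S.Full] [S.Faithful] [RepresentablyCoflat S] (h : HasWeakColimitsOfShape J K) :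
    HasWeakColimitsOfShape J C := by
  intro D
  obtain ⟨W, hW⟩ := h (D ⋙ S)
  obtain ⟨t, q, hq⟩ : ∃ (t : Cocone D) (q : S.obj t.pt ⟶ W.pt),
      ∀ j, S.map (t.ι.app j) ≫ q = W.ι.app j :=
    nonempty_cocone_costructuredArrow_iff.1 <|
      IsFiltered.cocone_nonempty (W.toCostructuredArrow ⋙ CostructuredArrow.pre D S W.pt)
  refine ⟨t, fun s ↦ ?_⟩
  obtain ⟨d, hd⟩ := hW (S.mapCocone s)
  refine ⟨S.preimage (q ≫ d), fun j ↦ S.map_injective ?_⟩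
  rw [Functor.map_comp, Functor.map_preimage, reassoc_of% hq, hd, Functor.mapCocone_ι_app]

end CostructuredArrow

section FilteredElements

lemma isFiltered_iff_nonempty_cocone {E : Type*} [Category* E] :
    IsFiltered E ↔ ((∀ F : Discrete PEmpty.{1} ⥤ E, Nonempty (Cocone F)) ∧
      ∀ F : Discrete WalkingPair ⥤ E, Nonempty (Cocone F)) ∧
      ∀ F : WalkingParallelPair ⥤ E, Nonempty (Cocone F) := by
  refine ⟨fun _ ↦ ⟨⟨IsFiltered.cocone_nonempty, IsFiltered.cocone_nonempty⟩,
    IsFiltered.cocone_nonempty⟩, fun ⟨⟨h_empty, h_pair⟩, h_parallel⟩ ↦ ?_⟩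
  exact
    { nonempty := (h_empty (Functor.empty E)).map Cocone.pt
      cocone_objs X Y := by
        obtain ⟨c⟩ := h_pair (pair X Y)
        exact ⟨c.pt, c.ι.app ⟨.left⟩, c.ι.app ⟨.right⟩, trivial⟩
      cocone_maps X Y f g := by
        obtain ⟨c⟩ := h_parallel (parallelPair f g)
        exact ⟨c.pt, c.ι.app .one, (c.w WalkingParallelPairHom.left).trans
          (c.w WalkingParallelPairHom.right).symm⟩ }

variable {K : Type u} [Category.{v} K]

lemma isFinitelyPresentable_colimit {J : Type} [SmallCategory J] [FinCategory J] (F : J ⥤ K)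
    [HasColimit F] [∀ j, IsFinitelyPresentable.{v} (F.obj j)] :
    IsFinitelyPresentable.{v} (colimit F) :=
  have := Cardinal.fact_isRegular_aleph0.{v}
  isCardinalPresentable_of_isColimit _ (colimit.isColimit F) Cardinal.aleph0.{v} <|
    (hasCardinalLT_aleph0_iff _).2 inferInstance

lemma isInjectiveWrt_colimitDesc_iff {J : Type*} [Category* J] {F : J ⥤ K} [HasColimit F]
    {c : Cocone F} {X : K} :
    IsInjectiveWrt X (colimit.desc F c) ↔
      ∀ α : F ⟶ (Functor.const J).obj X, ∃ b : c.pt ⟶ X, ∀ j, c.ι.app j ≫ b = α.app j := by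
  have desc_comp_eq_iff (a : colimit F ⟶ X) (b : c.pt ⟶ X) :
      colimit.desc F c ≫ b = a ↔ ∀ j, c.ι.app j ≫ b = colimit.ι F j ≫ a := by
    simp only [colimit.hom_ext_iff, colimit.ι_desc_assoc]
  simp only [IsInjectiveWrt, desc_comp_eq_iff]
  refine ⟨fun h α ↦ ?_, fun h a ↦ h ((colimit.cocone F).extend a).ι⟩
  simpa using h (colimit.desc F ⟨X, α⟩)

section

variable {J C : Type*} [Category* J] [Category* C] {S : C ⥤ K} {X : K}

lemma nonempty_cocone_of_isInjectiveWrt {F : J ⥤ CostructuredArrow S X}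
    {c : Cocone (F ⋙ CostructuredArrow.proj S X)}
    [HasColimit ((F ⋙ CostructuredArrow.proj S X) ⋙ S)]
    (h : IsInjectiveWrt X (colimit.desc _ (S.mapCocone c))) : Nonempty (Cocone F) :=
  nonempty_cocone_costructuredArrow_iff.2
    ⟨c, isInjectiveWrt_colimitDesc_iff.1 h (Cocone.fromCostructuredArrow S F).ι⟩

lemma IsWeakColimit.isInjectiveWrt {D : J ⥤ C} [HasColimit (D ⋙ S)] {c : Cocone D}
    (hc : IsWeakColimit c) (hX : ∀ F : J ⥤ CostructuredArrow S X, Nonempty (Cocone F)) :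
    IsInjectiveWrt X (colimit.desc (D ⋙ S) (S.mapCocone c)) := by
  refine isInjectiveWrt_colimitDesc_iff.2 fun α ↦ ?_
  obtain ⟨t, q, hq⟩ : ∃ (t : Cocone D) (q : S.obj t.pt ⟶ X),
      ∀ j, S.map (t.ι.app j) ≫ q = α.app j :=
    nonempty_cocone_costructuredArrow_iff.1 <|
      hX ((Cocone.mk X α).toCostructuredArrow ⋙ CostructuredArrow.pre D S X)
  obtain ⟨d, hd⟩ := hc t
  refine ⟨S.map d ≫ q, fun j ↦ ?_⟩
  rw [← hq j, ← hd j, Functor.map_comp, Category.assoc, Functor.mapCocone_ι_app]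

end

variable {C : Type v} [SmallCategory C] {S : C ⥤ K} [∀ c, IsFinitelyPresentable.{v} (S.obj c)]

lemma HasWeakColimitsOfShape.isFiniteInjectivityClass_nonempty_cocone {J : Type}
    [SmallCategory J] [FinCategory J] [HasColimitsOfShape J K] (h : HasWeakColimitsOfShape J C) :
    IsFiniteInjectivityClass fun X : K ↦
      ∀ F : J ⥤ CostructuredArrow S X, Nonempty (Cocone F) := by
  choose c hc using h
  refine ⟨.ofHoms fun D : J ⥤ C ↦ colimit.desc (D ⋙ S) (S.mapCocone (c D)), inferInstance,
    ?_, fun X ↦ ⟨?_, fun hX F ↦ nonempty_cocone_of_isInjectiveWrt (hX _ ⟨_⟩)⟩⟩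
  · rintro _ _ _ ⟨D⟩
    have (j : J) : IsFinitelyPresentable.{v} ((D ⋙ S).obj j) :=
      inferInstanceAs (IsFinitelyPresentable.{v} (S.obj (D.obj j)))
    exact ⟨isFinitelyPresentable_colimit _,
      inferInstanceAs (IsFinitelyPresentable.{v} (S.obj (c D).pt))⟩
  · rintro hX _ _ _ ⟨D⟩
    exact (hc D).isInjectiveWrt hX

theorem HasFiniteWeakColimits.isFiniteInjectivityClass_isFiltered_costructuredArrow
    [HasFiniteColimits K] (hC : HasFiniteWeakColimits C) :
    IsFiniteInjectivityClass fun X : K ↦ IsFiltered (CostructuredArrow S X) := by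
  simp only [isFiltered_iff_nonempty_cocone]
  have h (J : Type) [SmallCategory J] [FinCategory J] :=
    (hC J).isFiniteInjectivityClass_nonempty_cocone (S := S)
  exact ((h (Discrete PEmpty)).inf (h (Discrete WalkingPair))).inf (h WalkingParallelPair)

end FilteredElements

section Ind

variable {C : Type v} [SmallCategory C]

lemma essImage_indInclusion : (Ind.inclusion C).essImage = IsIndObject (C := C) := by
  ext P
  refine ⟨fun ⟨X, ⟨e⟩⟩ ↦ X.isIndObject_inclusion_obj.map e.hom, fun h ↦ ?_⟩
  exact ⟨(Ind.equivalence C).inverse.obj ⟨P, h⟩,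
    ⟨(ObjectProperty.ι _).mapIso ((Ind.equivalence C).counitIso.app ⟨P, h⟩)⟩⟩

lemma isIndObject_iff_isFiltered {P : Cᵒᵖ ⥤ Type v} :
    IsIndObject P ↔ IsFiltered (CostructuredArrow yoneda P) := by
  have := finallySmall_of_essentiallySmall.{v} (CostructuredArrow yoneda P)
  rw [isIndObject_iff, and_iff_left this]

instance isFinitelyPresentable_yoneda_obj (c : C) :
    IsFinitelyPresentable.{v} (yoneda.obj c) :=
  have := Cardinal.fact_isRegular_aleph0.{v}
  isCardinalPresentable_of_iso (uliftYonedaIsoYoneda.{v}.app c) _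

theorem HasFiniteWeakColimits.isFiniteInjectivityClass_essImage_indInclusion
    (hC : HasFiniteWeakColimits C) : IsFiniteInjectivityClass (Ind.inclusion C).essImage := by
  have h_essImage : (Ind.inclusion C).essImage =
      fun P ↦ IsFiltered (CostructuredArrow yoneda P) := by
    ext P
    rw [essImage_indInclusion, isIndObject_iff_isFiltered]
  rw [h_essImage]
  exact hC.isFiniteInjectivityClass_isFiltered_costructuredArrow

end Ind

section IndEquivalence

open Presheaf (restrictedULiftYoneda)

variable {L : Type u} [Category.{v} L] {C : Type v} [SmallCategory C] (i : C ⥤ L)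

/-- For `i` fully faithful, the restricted Yoneda functor `X ↦ Hom(i -, X)` along `i` extends the
Yoneda embedding of `C`. The universe parameter `v` makes the `ULift` in it invisible: presheaves
still take values in `Type v`. -/
noncomputable def compRestrictedULiftYonedaIso [i.Full] [i.Faithful] :
    i ⋙ restrictedULiftYoneda.{v} i ≅ yoneda :=
  (Functor.FullyFaithful.ofFullyFaithful i).compUliftYonedaCompWhiskeringLeft ≪≫
    uliftYonedaIsoYoneda

variable [∀ c, IsFinitelyPresentable.{v} (i.obj c)]

lemma preservesColimitsOfShape_restrictedULiftYoneda (J : Type v) [SmallCategory J]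
    [IsFiltered J] : PreservesColimitsOfShape J (restrictedULiftYoneda.{v} i) :=
  preservesColimitsOfShape_of_evaluation _ _ fun c ↦
    preservesColimitsOfShape_of_natIso (F := coyoneda.obj (.op (i.obj c.unop)))
      (NatIso.ofComponents fun X ↦ Equiv.ulift.symm.toIso)

variable [i.Full] [i.Faithful]

lemma isIndObject_restrictedULiftYoneda_obj [i.IsDense] [RepresentablyCoflat i] (X : L) :
    IsIndObject ((restrictedULiftYoneda.{v} i).obj X) :=
  have := preservesColimitsOfShape_restrictedULiftYoneda i (CostructuredArrow i X)
  have hX := isColimitOfPreserves (restrictedULiftYoneda.{v} i) (i.denseAt X)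
  let α : CostructuredArrow.proj i X ⋙ yoneda ≅
    (CostructuredArrow.proj i X ⋙ i) ⋙ restrictedULiftYoneda.{v} i :=
      Functor.isoWhiskerLeft _ (compRestrictedULiftYonedaIso i).symm
  .mk (.ofCocone _ ((IsColimit.precomposeHomEquiv α _).symm hX))

lemma mem_essImage_restrictedULiftYoneda [HasFilteredColimits L] {P : Cᵒᵖ ⥤ Type v}
    (hP : IsIndObject P) : (restrictedULiftYoneda.{v} i).essImage P := by
  let p := hP.presentation
  have := preservesColimitsOfShape_restrictedULiftYoneda i p.I
  have h_colimit := isColimitOfPreserves (restrictedULiftYoneda.{v} i)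
    (colimit.isColimit (p.F ⋙ i))
  exact ⟨colimit (p.F ⋙ i), ⟨h_colimit.coconePointsIsoOfNatIso p.isColimit
    (Functor.isoWhiskerLeft p.F (compRestrictedULiftYonedaIso i))⟩⟩

theorem nonempty_equivalence_ind [i.IsDense] [RepresentablyCoflat i] [HasFilteredColimits L] :
    Nonempty (L ≌ Ind C) := by
  have h_essImage : (restrictedULiftYoneda.{v} i).essImage = IsIndObject (C := C) :=
    le_antisymm (fun _ ⟨X, ⟨e⟩⟩ ↦ (isIndObject_restrictedULiftYoneda_obj i X).map e.hom)
      fun _ ↦ mem_essImage_restrictedULiftYoneda i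
  have : (restrictedULiftYoneda.{v} i).toEssImage.IsEquivalence := { }
  exact ⟨(restrictedULiftYoneda.{v} i).toEssImage.asEquivalence.trans
    ((ObjectProperty.fullSubcategoryCongr h_essImage).trans (Ind.equivalence C).symm)⟩

end IndEquivalence

theorem exists_equivalence_ind (L : Type u) [Category.{v} L]
    [IsFinitelyAccessibleCategory.{v} L] :
    ∃ (C : Type v) (_ : SmallCategory C), Nonempty (L ≌ Ind C) := by
  let P := ObjectProperty.isFinitelyPresentable.{v} L
  let e := (equivSmallModel.{v} P.FullSubcategory).symm
  have (c : SmallModel.{v} P.FullSubcategory) :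
      IsFinitelyPresentable.{v} ((e.functor ⋙ P.ι).obj c) :=
    (e.functor.obj c).property
  have : RepresentablyCoflat P.ι := ⟨inferInstance⟩
  have : HasFilteredColimits L :=
    HasCardinalFilteredColimits_iff_hasFilteredColimits.1 inferInstance
  exact ⟨_, _, nonempty_equivalence_ind (e.functor ⋙ P.ι)⟩

end DefinableCat

theorem proposition2p2p7_general (L : Type u) [Category.{v} L] [IsFinitelyAccessibleCategory.{v} L]
    (hL : DefinableCat.HasFiniteWeakColimits L) :
    DefinableCat.IsDefinable L ∧
    (∃ (C : Type v) (_ : SmallCategory C), Nonempty (L ≌ Ind C)) ∧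
    ∀ (C : Type v) [SmallCategory C], Nonempty (L ≌ Ind C) →
      DefinableCat.IsFiniteInjectivityClass (Ind.inclusion C).essImage := by
  have isFiniteInjectivityClass (C : Type v) [SmallCategory C] (e : L ≌ Ind C) :
      DefinableCat.IsFiniteInjectivityClass (Ind.inclusion C).essImage :=
    have hC : DefinableCat.HasFiniteWeakColimits C := fun J _ _ ↦
      .of_representablyCoflat (Ind.yoneda ⋙ e.inverse) (hL J)
    hC.isFiniteInjectivityClass_essImage_indInclusion
  obtain ⟨C, _, ⟨e⟩⟩ := DefinableCat.exists_equivalence_ind L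
  refine ⟨?_, ⟨C, _, ⟨e⟩⟩, fun C _ ⟨e⟩ ↦ isFiniteInjectivityClass C e⟩
  refine DefinableCat.isDefinable_of_isFiniteInjectivityClass_essImage
    (e.functor ⋙ Ind.inclusion C) ?_
  rw [Functor.essImage_comp_of_essSurj]
  exact isFiniteInjectivityClass C e

/-- Let `L` be weakly locally finitely presentable. Then `L` is definable. Moreover `L` is of the
form `Ind C` for a small category `C`; and, for each such `C`, the (fully faithful) inclusion
identifies `Ind C` with a finite-injectivity class in the presheaf category `Cᵒᵖ ⥤ Type v`. -/
theorem proposition2p2p7 (L : Type u) [Category.{v} L]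
    (hL : DefinableCat.IsWeaklyLocallyFinitelyPresentable L) :
    DefinableCat.IsDefinable L ∧
    (∃ (C : Type v) (_ : SmallCategory C), Nonempty (L ≌ Ind C)) ∧
    ∀ (C : Type v) [SmallCategory C], Nonempty (L ≌ Ind C) →
      DefinableCat.IsFiniteInjectivityClass (Ind.inclusion C).essImage :=
  have := hL.isFinitelyAccessible
  proposition2p2p7_general L hL.hasWeakColimits.hasFiniteWeakColimits
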